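/- Let $\mathcal{L}$ be the first-order language of set theory, with one binary relation symbol $\in$ (and equality). Mac Lane set theory $\mathrm{Mac}$ is the $\mathcal{L}$-theory with the axioms of extensionality, empty set, pairing, union, power set, infinity, transitive containment (every set is a subset of a transitive set), foundation (every nonempty set $x$ has an element disjoint from $x$), and the scheme of separation for all $\Delta_0$ formulas (formulas all of whose quantifiers are bounded, $\forall x \in y$ or $\exists x \in y$), with parameters. For an $\mathcal{L}$-structure $\mathcal{N}$, let $\mathrm{Ord}^{\mathcal{N}}$ be the class of those $\alpha$ in $\mathcal{N}$ with $\mathcal{N} \models \text{``}\alpha\text{ is an ordinal''}$ and let $\omega^{\mathcal{N}}$ be the element that $\mathcal{N}$ takes to be $\omega$, the least inductive set (it exists and is unique if $\mathcal{N} \models \mathrm{Mac}$). For ordinals $\alpha, \beta$ of $\mathcal{N}$, write $\alpha < \beta$ for $\mathcal{N} \models \alpha \in \beta$ and $\alpha \leq \beta$ for $\alpha < \beta$ or $\alpha = \beta$. **Theorem.** Let $M$ be a transitive set such that $\langle M, \in \rangle \models \mathrm{Mac}$. Then there are an $\mathcal{L}$-structure $\mathcal{N}$ that is elementarily equivalent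 to $\langle M, \in \rangle$ and an automorphism $j : \mathcal{N} \to \mathcal{N}$ such that (i) $j(\alpha) \geq \alpha$ for all $\alpha \in \mathrm{Ord}^{\mathcal{N}}$, and (ii) there is an $n$ with $\mathcal{N} \models n \in \omega^{\mathcal{N}}$ and $j(n) > n$. -/

import Mathlib

open FirstOrder

namespace MacLane

/-- The symbols of the language of set theory: one binary relation symbol. -/
inductive SetRel : ℕ → Type
  | mem : SetRel 2

/-- The language of set theory (equality is a logical symbol). -/
def setLang : FirstOrder.Language.{0, 0} := ⟨fun _ => Empty, SetRel⟩

/-- The atomic formula `t ∈ s`. -/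
def memF {α : Type} {n : ℕ} (t s : setLang.Term (α ⊕ Fin n)) : setLang.BoundedFormula α n :=
  FirstOrder.Language.Relations.boundedFormula₂ (L := setLang) SetRel.mem t s

local infix:89 " ∊ " => memF

/-- The `Δ₀` formulas: the least class of formulas that contains the atomic formulas and is closed
under the propositional connectives (`⊥` and `⟹` generate them) and under the bounded quantifiers
`∀ x ∈ y` and `∃ x ∈ y`, where the variable `y` is different from `x`. -/
inductive IsDelta0 {α : Type} : {n : ℕ} → setLang.BoundedFormula α n → Prop
  | falsum {n : ℕ} : IsDelta0 (⊥ : setLang.BoundedFormula α n)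
  | equal {n : ℕ} (t s : setLang.Term (α ⊕ Fin n)) : IsDelta0 (t =' s)
  | mem {n : ℕ} (t s : setLang.Term (α ⊕ Fin n)) : IsDelta0 (t ∊ s)
  | imp {n : ℕ} {φ ψ : setLang.BoundedFormula α n} :
      IsDelta0 φ → IsDelta0 ψ → IsDelta0 (φ ⟹ ψ)
  | ball {n : ℕ} (y : α ⊕ Fin n) {φ : setLang.BoundedFormula α (n + 1)} :
      IsDelta0 φ →
        IsDelta0 (∀' ((&(Fin.last n) ∊ FirstOrder.Language.Term.var (Sum.map id Fin.castSucc y)) ⟹ φ))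
  | bex {n : ℕ} (y : α ⊕ Fin n) {φ : setLang.BoundedFormula α (n + 1)} :
      IsDelta0 φ →
        IsDelta0 (∃' ((&(Fin.last n) ∊ FirstOrder.Language.Term.var (Sum.map id Fin.castSucc y)) ⊓ φ))

/-! In the sentences below, `&k` is the variable bound by the `k`-th quantifier from outside,
counted from `0`. -/

/-- Extensionality: sets with the same elements are equal. -/
def extensionality : setLang.Sentence :=
  ∀' (∀' ((∀' ((&2 ∊ &0) ⇔ (&2 ∊ &1))) ⟹ (&0 =' &1)))

/-- There is an empty set. -/
def emptyset : setLang.Sentence :=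
  ∃' (∀' (∼(&1 ∊ &0)))

/-- Pairing: `{x, y}` exists. -/
def pairing : setLang.Sentence :=
  ∀' (∀' (∃' (∀' ((&3 ∊ &2) ⇔ ((&3 =' &0) ⊔ (&3 =' &1))))))

/-- Union: `⋃ x` exists. -/
def union : setLang.Sentence :=
  ∀' (∃' (∀' ((&2 ∊ &1) ⇔ (∃' ((&3 ∊ &0) ⊓ (&2 ∊ &3))))))

/-- Powerset: `𝒫 x` exists. -/
def powerset : setLang.Sentence :=
  ∀' (∃' (∀' ((&2 ∊ &1) ⇔ (∀' ((&3 ∊ &2) ⟹ (&3 ∊ &0))))))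

/-- Infinity: some set has the empty set as an element and is closed under `y ↦ y ∪ {y}`. -/
def infinity : setLang.Sentence :=
  ∃' ((∃' ((&1 ∊ &0) ⊓ (∀' (∼(&2 ∊ &1))))) ⊓
    (∀' ((&1 ∊ &0) ⟹ (∃' ((&2 ∊ &0) ⊓ (∀' ((&3 ∊ &2) ⇔ ((&3 ∊ &1) ⊔ (&3 =' &1)))))))))

/-- Transitive containment: every set is a subset of a transitive set. -/
def transitiveContainment : setLang.Sentence :=
  ∀' (∃' ((∀' ((&2 ∊ &0) ⟹ (&2 ∊ &1))) ⊓
    (∀' ((&2 ∊ &1) ⟹ (∀' ((&3 ∊ &2) ⟹ (&3 ∊ &1)))))))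

/-- Foundation: every nonempty set `x` has an element that is disjoint from `x`. -/
def foundation : setLang.Sentence :=
  ∀' ((∃' (&1 ∊ &0)) ⟹ (∃' ((&1 ∊ &0) ⊓ (∀' ((&2 ∊ &1) ⟹ (∼(&2 ∊ &0)))))))

/-- The instance of separation for `φ(p₀, …, pₙ₋₁, x)`, with the parameter `pᵢ` as the free variable
`Sum.inl i` and `x` as the free variable `Sum.inr ()`:
`∀ p₀ … pₙ₋₁ ∀ a ∃ b ∀ x (x ∈ b ↔ x ∈ a ∧ φ(p₀, …, pₙ₋₁, x))`. -/
def separation {n : ℕ} (φ : setLang.Formula (Fin n ⊕ Unit)) : setLang.Sentence :=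
  let φ' : setLang.BoundedFormula Empty (n + 3) :=
    FirstOrder.Language.BoundedFormula.relabel (k := 0)
      (Sum.elim (fun i => Sum.inr (Fin.castAdd 3 i)) (fun _ => Sum.inr (Fin.last (n + 2)))) φ
  let a : Fin (n + 3) := Fin.natAdd n 0
  let b : Fin (n + 3) := Fin.natAdd n 1
  let x : Fin (n + 3) := Fin.natAdd n 2
  FirstOrder.Language.BoundedFormula.alls (∀' (∃' (∀' ((&x ∊ &b) ⇔ ((&x ∊ &a) ⊓ φ')))))

/-- Mac Lane set theory. -/
def Mac : setLang.Theory :=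
  {extensionality, emptyset, pairing, union, powerset, infinity, transitiveContainment,
      foundation} ∪
    {σ | ∃ (n : ℕ) (φ : setLang.Formula (Fin n ⊕ Unit)), IsDelta0 φ ∧ σ = separation φ}

/-- The structure `⟨M, ∈⟩` of a set `M`. -/
instance memStructure (M : ZFSet) : setLang.Structure M where
  funMap := fun f => nomatch f
  RelMap | .mem => fun v => (v 0 : ZFSet) ∈ (v 1 : ZFSet)

section Internal

variable {N : Type} [setLang.Structure N]

/-- `N ⊨ x ∈ y`. -/
def Mem (x y : N) : Prop :=
  FirstOrder.Language.Structure.RelMap (L := setLang) SetRel.mem ![x, y]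

/-- `N ⊨ α is an ordinal`: `α` is transitive and linearly ordered by `∈`
(which is the usual definition in the presence of the axiom of foundation). -/
def IsOrd (α : N) : Prop :=
  (∀ x y : N, Mem x α → Mem y x → Mem y α) ∧
    ∀ x y : N, Mem x α → Mem y α → Mem x y ∨ x = y ∨ Mem y x

/-- `N ⊨ x is inductive`: `x` has the empty set as an element and is closed under
`y ↦ y ∪ {y}`. -/
def IsInductive (x : N) : Prop :=
  (∃ e : N, Mem e x ∧ ∀ z : N, ¬ Mem z e) ∧
    ∀ y : N, Mem y x → ∃ s : N, Mem s x ∧ ∀ z : N, Mem z s ↔ Mem z y ∨ z = y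

/-- `N ⊨ w = ω`: `w` is the least inductive set. -/
def IsOmega (w : N) : Prop :=
  IsInductive w ∧ ∀ v : N, IsInductive v → ∀ n : N, Mem n w → Mem n v

end Internal

end MacLane

/-! Replace `M` by a small elementarily equivalent well-founded `A` and iterate the ultrapower of
`A` by a nonprincipal ultrafilter on `ℕ` along the order `ℤ`: elements are functions of `v : ℤ → ℕ`
depending on finitely many coordinates, identified when they agree at generic `v`. Łoś's theorem
(`IterPower.realize_mk`) gives elementary equivalence, and since genericity is translation invariant
(`eventually_generic_shift`), translation of `ℤ` induces an automorphism `j`. Each generic entry is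
chosen after those to its left, so `v 0 < v 1` generically, and `j` raises the natural number
represented by `v 0`. If `j` lowered the ordinal represented by `f`, then `f (shift 1 v) ∈ f v`
would hold generically. This involves finitely many coordinates, so actual entries can be chosen one
after another to give an infinite descending sequence in `A`, which is impossible
(`not_eventually_generic_descending`). -/

namespace MacLane
open Filter

/-! ### Generic bi-infinite sequences. -/

section Generic

/-- Translation of a bi-infinite sequence. -/
def shift (k : ℤ) (v : ℤ → ℕ) : ℤ → ℕ := fun i => v (i + k)

/-- Translate a sequence to the left and put `x` at the position `-1`. -/
def push (x : ℕ) (v : ℤ → ℕ) : ℤ → ℕ := fun i => if i = -1 then x else v (i + 1)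

/-- `f` depends only on the coordinates in `[a, b)`. -/
def DepOn {β : Type*} (a b : ℤ) (f : (ℤ → ℕ) → β) : Prop :=
  ∀ v w : ℤ → ℕ, (∀ i, a ≤ i → i < b → v i = w i) → f v = f w

theorem shift_shift (k l : ℤ) (v : ℤ → ℕ) : shift k (shift l v) = shift (k + l) v := by
  funext i; simp [shift, add_assoc]

theorem shift_zero (v : ℤ → ℕ) : shift 0 v = v := by
  funext i; simp [shift]

theorem DepOn.mono {β : Type*} {a b a' b' : ℤ} {f : (ℤ → ℕ) → β} (h : DepOn a b f)
    (ha : a' ≤ a) (hb : b ≤ b') : DepOn a' b' f :=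
  fun v w hvw => h v w fun i h1 h2 => hvw i (ha.trans h1) (h2.trans_le hb)

theorem DepOn.comp_shift {β : Type*} {a b : ℤ} {f : (ℤ → ℕ) → β} (h : DepOn a b f) (k : ℤ) :
    DepOn (a + k) (b + k) (fun v => f (shift k v)) :=
  fun v w hvw => h _ _ fun i h1 h2 => hvw (i + k) (by omega) (by omega)

theorem DepOn.comp₂ {β γ δ : Type*} {a b : ℤ} {f : (ℤ → ℕ) → β} {g : (ℤ → ℕ) → γ}
    (hf : DepOn a b f) (hg : DepOn a b g) (F : β → γ → δ) : DepOn a b (fun v => F (f v) (g v)) :=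
  fun v w hvw => by simp only [hf v w hvw, hg v w hvw]

/-- `P` holds after pushing `n` successive generic entries onto `v`. -/
def Gen : ℕ → ((ℤ → ℕ) → Prop) → (ℤ → ℕ) → Prop
  | 0, P, v => P v
  | n + 1, P, v => ∀ᶠ x in (hyperfilter ℕ : Filter ℕ), Gen n P (push x v)

/-- The ultrafilter whose membership predicate is `Gen`. -/
noncomputable def genUltrafilter : ℕ → (ℤ → ℕ) → Ultrafilter (ℤ → ℕ)
  | 0, v => pure v
  | n + 1, v => (hyperfilter ℕ).bind fun x => genUltrafilter n (push x v)

theorem eventually_genUltrafilter (n : ℕ) (v : ℤ → ℕ) (P : (ℤ → ℕ) → Prop) :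
    (∀ᶠ w in (genUltrafilter n v : Filter (ℤ → ℕ)), P w) ↔ Gen n P v := by
  induction n generalizing v with
  | zero => exact Iff.rfl
  | succ n ih =>
    exact Filter.eventually_congr (Filter.Eventually.of_forall fun x => ih (push x v))

/-- After `n` pushes the window `[-r, 0)` holds new entries and at most the last `r - n` old ones.
-/
theorem gen_congr_of_agree {r : ℕ} {P : (ℤ → ℕ) → Prop} (hP : DepOn (-r) 0 P) (n : ℕ) :
    ∀ (m : ℕ) (v w : ℤ → ℕ), r ≤ n + m → (∀ i, -(m : ℤ) ≤ i → i < 0 → v i = w i) →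
      (Gen n P v ↔ Gen n P w) := by
  induction n with
  | zero =>
    intro m v w h hvw
    exact iff_of_eq (hP v w fun i h1 h2 => hvw i (by omega) h2)
  | succ n ih =>
    intro m v w h hvw
    refine Filter.eventually_congr (Filter.Eventually.of_forall fun x => ?_)
    refine ih (m + 1) _ _ (by omega) fun i h1 h2 => ?_
    by_cases hi : i = -1
    · simp [push, hi]
    · simp only [push, hi, if_false]
      exact hvw _ (by push_cast at h1; omega) (by omega)

/-- The last `n` pushes fill the window on their own: the first entry and the starting sequence have
moved out of it. -/
theorem gen_succ_iff {r : ℕ} {P : (ℤ → ℕ) → Prop} (hP : DepOn (-r) 0 P) {n : ℕ} (hn : r ≤ n)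
    (v w : ℤ → ℕ) : Gen (n + 1) P v ↔ Gen n P w := by
  have : ∀ x, Gen n P (push x v) ↔ Gen n P w := fun x =>
    gen_congr_of_agree hP n 0 _ _ (by omega) fun i h1 h2 => by simp at h1; omega
  simp only [Gen, this, Filter.eventually_const]

/-- The recursion of `Gen` peels off the first push; this isolates the last one. -/
theorem gen_succ' (n : ℕ) (P : (ℤ → ℕ) → Prop) (v : ℤ → ℕ) :
    Gen (n + 1) P v ↔
      Gen n (fun w => ∀ᶠ x in (hyperfilter ℕ : Filter ℕ), P (push x w)) v := by
  induction n generalizing v with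
  | zero => exact Iff.rfl
  | succ n ih => exact Filter.eventually_congr (Filter.Eventually.of_forall fun x => ih (push x v))

theorem dep_shift_push {β : Type*} {a : ℤ} {f : (ℤ → ℕ) → β} (hf : DepOn a 0 f) (x : ℕ)
    (w : ℤ → ℕ) : f (shift (-1) (push x w)) = f w :=
  hf _ _ fun i _ h2 => by
    have : i + -1 ≠ -1 := by omega
    simp [shift, push, this]

theorem gen_succ_shift {a : ℤ} {P : (ℤ → ℕ) → Prop} (hP : DepOn a 0 P) (n : ℕ) (v : ℤ → ℕ) :
    Gen (n + 1) (fun w => P (shift (-1) w)) v ↔ Gen n P v := by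
  rw [gen_succ']
  simp only [dep_shift_push hP, Filter.eventually_const]

/-- Filling `[-n, n)` takes `2 * n` pushes and a translation. Passing to `n + 1` adds one outermost
and one innermost push, and `P` sees neither. -/
theorem gen_shift_stable {r : ℕ} {P : (ℤ → ℕ) → Prop} (hP : DepOn (-r) r P) {n : ℕ} (hn : r ≤ n) :
    Gen (2 * n) (fun w => P (shift (-n) w)) 0 ↔ Gen (2 * r) (fun w => P (shift (-r) w)) 0 := by
  induction n, hn using Nat.le_induction with
  | base => rfl
  | succ n hn ih =>
    have hd : DepOn (-(r + n : ℕ)) 0 (fun w => P (shift (-n) w)) :=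
      (hP.comp_shift (-n)).mono (by push_cast; omega) (by omega)
    rw [← ih, ← gen_succ_iff hd (n := 2 * n) (by omega) 0 0, ← gen_succ_shift hd]
    simp only [shift_shift]
    have : (-(n : ℤ) + -1) = -((n + 1 : ℕ) : ℤ) := by push_cast; ring
    rw [this]
    rfl

/-- An ultrafilter for which a bi-infinite sequence is increasingly generic. -/
noncomputable def generic : Ultrafilter (ℤ → ℕ) :=
  (hyperfilter ℕ).bind fun n => (genUltrafilter (2 * n) 0).map (shift (-n))

theorem eventually_generic {r : ℕ} {P : (ℤ → ℕ) → Prop} (hP : DepOn (-r) r P) {n : ℕ}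
    (hn : r ≤ n) :
    (∀ᶠ v in (generic : Filter (ℤ → ℕ)), P v) ↔ Gen (2 * n) (fun w => P (shift (-n) w)) 0 := by
  have h : (∀ᶠ v in (generic : Filter (ℤ → ℕ)), P v) ↔
      ∀ᶠ n in (hyperfilter ℕ : Filter ℕ), Gen (2 * n) (fun w => P (shift (-(n : ℤ)) w)) 0 :=
    Filter.eventually_congr (Filter.Eventually.of_forall fun n =>
      eventually_genUltrafilter (2 * n) 0 (fun w => P (shift (-(n : ℤ)) w)))
  rw [h, gen_shift_stable hP hn]
  refine Iff.trans (Filter.eventually_congr ?_)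
    (Filter.eventually_const (f := (hyperfilter ℕ : Filter ℕ)))
  have : ∀ᶠ k in (hyperfilter ℕ : Filter ℕ), r ≤ k :=
    (Nat.hyperfilter_le_atTop) (Filter.eventually_ge_atTop r)
  filter_upwards [this] with k hk using gen_shift_stable hP hk

/-- Both sides read off `P (shift (-r) w)`, after `2 * r + 2` and `2 * r` pushes; the two extra
outermost pushes do not matter. -/
theorem eventually_generic_shift {r : ℕ} {P : (ℤ → ℕ) → Prop} (hP : DepOn (-r) r P) :
    (∀ᶠ v in (generic : Filter (ℤ → ℕ)), P (shift 1 v)) ↔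
      ∀ᶠ v in (generic : Filter (ℤ → ℕ)), P v := by
  have hd : DepOn (-(r + 1 : ℕ)) (r + 1 : ℕ) (fun w => P (shift 1 w)) :=
    (hP.comp_shift 1).mono (by push_cast; omega) (by push_cast; omega)
  rw [eventually_generic hd le_rfl, eventually_generic hP le_rfl]
  have hd' : DepOn (-(2 * r : ℕ)) 0 (fun w => P (shift (-r) w)) :=
    (hP.comp_shift (-r)).mono (by push_cast; omega) (by omega)
  rw [← gen_succ_iff hd' (n := 2 * r) le_rfl 0 0,
    ← gen_succ_iff hd' (n := 2 * r + 1) (by omega) 0 0]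
  simp only [shift_shift]
  have : (1 + -((r + 1 : ℕ) : ℤ)) = -(r : ℤ) := by push_cast; ring
  rw [this]
  rfl

theorem eventually_generic_lt :
    ∀ᶠ v in (generic : Filter (ℤ → ℕ)), v 0 < v 1 := by
  have hd : DepOn (-(2 : ℕ)) (2 : ℕ) (fun v : ℤ → ℕ => v 0 < v 1) := fun v w h => by
    simp only [h 0 (by norm_num) (by norm_num), h 1 (by norm_num) (by norm_num)]
  rw [eventually_generic hd le_rfl]
  simp only [Gen, shift, push]
  -- After translation, `z` sits at `0` and the last pushed entry at `1`; nonprincipality makes the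
  -- latter larger.
  refine .of_forall fun _ => .of_forall fun _ => .of_forall fun z => ?_
  have : ∀ᶠ k in (hyperfilter ℕ : Filter ℕ), z < k :=
    (Nat.hyperfilter_le_atTop) (Filter.eventually_gt_atTop z)
  simpa using this

/-- A well-founded relation admits no generically descending function. -/
theorem not_eventually_generic_descending {β : Type*} {R : β → β → Prop} (hR : WellFounded R)
    {r : ℕ} {f : (ℤ → ℕ) → β} (hf : DepOn (-r) r f) :
    ¬ ∀ᶠ v in (generic : Filter (ℤ → ℕ)), R (f (shift 1 v)) (f v) := by
  intro h
  have hd : DepOn (-(r + 1 : ℕ)) (r + 1 : ℕ) (fun v => R (f (shift 1 v)) (f v)) :=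
    DepOn.comp₂ ((hf.comp_shift 1).mono (by push_cast; omega) (by push_cast; omega))
      (hf.mono (by push_cast; omega) (by push_cast; omega)) R
  rw [eventually_generic hd le_rfl] at h
  -- This exceeds the width `2 * r + 1` of the window of `Q` below, so `n` pushes erase the start.
  set n : ℕ := 2 * (r + 1) with hn
  set g : (ℤ → ℕ) → β := fun v => f (shift (-r) v) with hg
  have hgd : DepOn (-(2 * r : ℕ)) 0 g :=
    (hf.comp_shift (-r)).mono (by push_cast; omega) (by omega)
  -- Evaluated at `push x v`, this says `R (g (push x v)) (g v)`: a push makes `g` descend.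
  set Q : (ℤ → ℕ) → Prop := fun v => R (g v) (g (shift (-1) v)) with hQ
  have hQe : (fun v => R (f (shift 1 (shift (-(r + 1 : ℕ)) v))) (f (shift (-(r + 1 : ℕ)) v))) = Q := by
    funext v
    have e1 : (1 + -((r + 1 : ℕ) : ℤ)) = -(r : ℤ) := by push_cast; ring
    have e2 : (-(r : ℤ) + -1) = -((r + 1 : ℕ) : ℤ) := by push_cast; ring
    simp only [hQ, hg, shift_shift, e1, e2]
  have hQd : DepOn (-(n : ℕ)) 0 Q :=
    DepOn.comp₂ (hgd.mono (by push_cast; omega) (by omega))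
      ((hgd.comp_shift (-1)).mono (by push_cast; omega) (by omega)) R
  have hall : ∀ v, Gen n Q v := fun v => by
    rw [gen_congr_of_agree hQd n 0 v 0 (by omega) fun i h1 h2 => by simp at h1; omega]
    rw [← hQe]
    exact h
  -- Finitely many generic conditions share a witness `x`; the condition for `m = n` is free by
  -- `hall`.
  have step : ∀ (k : ℕ) (v : ℤ → ℕ), (∀ m, k + 1 ≤ m → m ≤ n → Gen m Q v) →
      ∃ x, ∀ m, k ≤ m → m ≤ n → Gen m Q (push x v) := by
    intro k v hv
    have : ∀ᶠ x in (hyperfilter ℕ : Filter ℕ), ∀ m ∈ Finset.Ico k n, Gen m Q (push x v) := by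
      rw [Filter.eventually_all_finset]
      intro m hm
      rw [Finset.mem_Ico] at hm
      exact hv (m + 1) (by omega) (by omega)
    obtain ⟨x, hx⟩ := this.exists
    refine ⟨x, fun m h1 h2 => ?_⟩
    rcases h2.lt_or_eq with h2 | rfl
    · exact hx m (Finset.mem_Ico.2 ⟨h1, h2⟩)
    · exact hall _
  have start : ∀ d : ℕ, ∃ v, ∀ m, n ≤ m + d → m ≤ n → Gen m Q v := by
    intro d
    induction d with
    | zero => exact ⟨0, fun m h1 h2 => by obtain rfl : m = n := by omega
                                          exact hall _⟩
    | succ d ih =>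
      obtain ⟨v, hv⟩ := ih
      obtain ⟨x, hx⟩ := step (n - (d + 1)) v fun m h1 h2 => hv m (by omega) h2
      exact ⟨_, fun m h1 h2 => hx m (by omega) h2⟩
  -- From such a `v`, some push leads to another one with smaller `g`.
  have noGood : ∀ b v, g v = b → ¬ ∀ m, 1 ≤ m → m ≤ n → Gen m Q v := by
    intro b
    induction b using hR.induction with
    | _ b ih =>
      rintro v rfl hv
      obtain ⟨x, hx⟩ := step 0 v hv
      have h0 : Q (push x v) := hx 0 le_rfl (Nat.zero_le _)
      simp only [hQ, dep_shift_push hgd] at h0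
      exact ih _ h0 _ rfl fun m h1 h2 => hx m (by omega) h2
  obtain ⟨v, hv⟩ := start n
  exact noGood _ v rfl fun m _ h2 => hv m (by omega) h2

end Generic
-- Formulas, `ω` and ordinals in models of `Mac`.
local infix:89 " ∊ " => memF

theorem snoc_at {N : Type*} {n : ℕ} (xs : Fin n → N) (a : N) (i : Fin (n + 1)) :
    (Fin.snoc xs a : Fin (n + 1) → N) i = if h : i.1 < n then xs ⟨i.1, h⟩ else a := by
  simp [Fin.snoc, Fin.castLT]

/-- The variable `y`, one quantifier further in. -/
def up {α : Type} {n : ℕ} (y : α ⊕ Fin n) : α ⊕ Fin (n + 1) := Sum.map id Fin.castSucc y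

/-- The most recently quantified variable. -/
def top {α : Type} {n : ℕ} : α ⊕ Fin (n + 1) := Sum.inr (Fin.last n)

theorem elim_up {N α : Type} {n : ℕ} (v : α → N) (xs : Fin n → N) (a : N) (y : α ⊕ Fin n) :
    Sum.elim v (Fin.snoc xs a : Fin (n + 1) → N) (up y) = Sum.elim v xs y := by
  cases y <;> simp [up]

theorem elim_top {N α : Type} {n : ℕ} (v : α → N) (xs : Fin n → N) (a : N) :
    Sum.elim v (Fin.snoc xs a : Fin (n + 1) → N) top = a := by
  simp [top]

section Type0

variable {N : Type} [setLang.Structure N]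

theorem realize_memF {α : Type} {n : ℕ} (t s : setLang.Term (α ⊕ Fin n)) (v : α → N)
    (xs : Fin n → N) :
    (t ∊ s).Realize v xs ↔ Mem (t.realize (Sum.elim v xs)) (s.realize (Sum.elim v xs)) := by
  exact FirstOrder.Language.BoundedFormula.realize_rel₂ (L := setLang)

theorem ext_of_models (h : N ⊨ Mac) (x y : N) (hxy : ∀ z, Mem z x ↔ Mem z y) : x = y := by
  have h0 : N ⊨ extensionality := h.realize_of_mem _ (by simp [Mac])
  simp [extensionality, FirstOrder.Language.Sentence.Realize, FirstOrder.Language.Formula.Realize,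
    realize_memF, snoc_at] at h0
  exact h0 x y hxy

theorem exists_powerset (h : N ⊨ Mac) (x : N) :
    ∃ p : N, ∀ y, Mem y p ↔ ∀ z, Mem z y → Mem z x := by
  have h0 : N ⊨ powerset := h.realize_of_mem _ (by simp [Mac])
  simp [powerset, FirstOrder.Language.Sentence.Realize, FirstOrder.Language.Formula.Realize,
    realize_memF, snoc_at] at h0
  exact h0 x

theorem exists_inductive (h : N ⊨ Mac) : ∃ x : N, IsInductive x := by
  have h0 : N ⊨ infinity := h.realize_of_mem _ (by simp [Mac])
  simp [infinity, FirstOrder.Language.Sentence.Realize, FirstOrder.Language.Formula.Realize,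
    realize_memF, snoc_at] at h0
  exact h0

theorem exists_separation (h : N ⊨ Mac) {n : ℕ} {φ : setLang.Formula (Fin n ⊕ Unit)}
    (hφ : IsDelta0 φ) (p : Fin n → N) (a : N) :
    ∃ b : N, ∀ x, Mem x b ↔ Mem x a ∧ φ.Realize (Sum.elim p fun _ => x) := by
  have h0 : N ⊨ separation φ := h.realize_of_mem _ (Or.inr ⟨n, φ, hφ, rfl⟩)
  simp only [separation, FirstOrder.Language.Sentence.Realize,
    FirstOrder.Language.BoundedFormula.realize_alls,
    FirstOrder.Language.BoundedFormula.realize_all, FirstOrder.Language.BoundedFormula.realize_ex,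
    FirstOrder.Language.BoundedFormula.realize_iff, FirstOrder.Language.BoundedFormula.realize_inf,
    FirstOrder.Language.BoundedFormula.realize_relabel, realize_memF,
    Function.comp_apply, FirstOrder.Language.Term.realize_var, Sum.elim_inr] at h0
  obtain ⟨b, hb⟩ := h0 p a
  refine ⟨b, fun x => ?_⟩
  have := hb x
  have e : (Sum.elim (default : Empty → N)
      ((Fin.snoc (Fin.snoc (Fin.snoc p a : Fin (n + 1) → N) b : Fin (n + 2) → N) x :
        Fin (n + 3) → N) ∘ Fin.castAdd 0) ∘
      Sum.elim (fun i => Sum.inr (Fin.castAdd 3 i)) (fun _ : Unit => Sum.inr (Fin.last (n + 2)))) =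
      Sum.elim p fun _ => x := by
    funext i
    rcases i with i | i
    · simp [snoc_at, Nat.lt_succ_of_lt (Nat.lt_succ_of_lt i.2)]
    · simp [snoc_at]
  rw [e] at this
  simp [snoc_at] at this
  rw [FirstOrder.Language.Formula.Realize, this]
  exact and_congr Iff.rfl (iff_of_eq (congrArg _ (Subsingleton.elim _ _)))

/-- `x ∈ y` for variables `x` and `y`. -/
def memV {α : Type} {n : ℕ} (x y : α ⊕ Fin n) : setLang.BoundedFormula α n :=
  FirstOrder.Language.Term.var x ∊ FirstOrder.Language.Term.var y

/-- `∀ z ∈ y, φ`. -/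
def ballF {α : Type} {n : ℕ} (y : α ⊕ Fin n) (φ : setLang.BoundedFormula α (n + 1)) :
    setLang.BoundedFormula α n :=
  ∀' ((&(Fin.last n) ∊ FirstOrder.Language.Term.var (Sum.map id Fin.castSucc y)) ⟹ φ)

/-- `∃ z ∈ y, φ`. -/
def bexF {α : Type} {n : ℕ} (y : α ⊕ Fin n) (φ : setLang.BoundedFormula α (n + 1)) :
    setLang.BoundedFormula α n :=
  ∃' ((&(Fin.last n) ∊ FirstOrder.Language.Term.var (Sum.map id Fin.castSucc y)) ⊓ φ)

theorem realize_memV {α : Type} {n : ℕ} (x y : α ⊕ Fin n) (v : α → N) (xs : Fin n → N) :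
    (memV x y).Realize v xs ↔ Mem (Sum.elim v xs x) (Sum.elim v xs y) :=
  realize_memF _ _ _ _

theorem realize_ballF {α : Type} {n : ℕ} (y : α ⊕ Fin n) (φ : setLang.BoundedFormula α (n + 1))
    (v : α → N) (xs : Fin n → N) :
    (ballF y φ).Realize v xs ↔ ∀ a, Mem a (Sum.elim v xs y) → φ.Realize v (Fin.snoc xs a) := by
  simp [ballF, realize_memF, ← up.eq_1, elim_up]

theorem realize_bexF {α : Type} {n : ℕ} (y : α ⊕ Fin n) (φ : setLang.BoundedFormula α (n + 1))
    (v : α → N) (xs : Fin n → N) :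
    (bexF y φ).Realize v xs ↔ ∃ a, Mem a (Sum.elim v xs y) ∧ φ.Realize v (Fin.snoc xs a) := by
  simp [bexF, realize_memF, ← up.eq_1, elim_up]

theorem IsDelta0.not {α : Type} {n : ℕ} {φ : setLang.BoundedFormula α n} (h : IsDelta0 φ) :
    IsDelta0 (∼φ) := h.imp .falsum

theorem IsDelta0.inf {α : Type} {n : ℕ} {φ ψ : setLang.BoundedFormula α n} (h : IsDelta0 φ)
    (h' : IsDelta0 ψ) : IsDelta0 (φ ⊓ ψ) := (h.imp h'.not).not

theorem IsDelta0.sup {α : Type} {n : ℕ} {φ ψ : setLang.BoundedFormula α n} (h : IsDelta0 φ)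
    (h' : IsDelta0 ψ) : IsDelta0 (φ ⊔ ψ) := h.not.imp h'

/-- The `Δ₀` formula saying that `y` is an inductive set. -/
def inductiveF {α : Type} {n : ℕ} (y : α ⊕ Fin n) : setLang.BoundedFormula α n :=
  bexF y (ballF top ⊥) ⊓
    ballF y (bexF (up y)
      -- To stay `Δ₀`, `s = a ∪ {a}` is split into `s ⊆ a ∪ {a}`, `a ⊆ s` and `a ∈ s`.
      (ballF top (memV top (up (up top)) ⊔
          FirstOrder.Language.Term.bdEqual (.var top) (.var (up (up top)))) ⊓
        (ballF (up top) (memV top (up top)) ⊓ memV (up top) top)))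

theorem isDelta0_inductiveF {α : Type} {n : ℕ} (y : α ⊕ Fin n) : IsDelta0 (inductiveF y) :=
  .inf (.bex _ (.ball _ .falsum))
    (.ball _ (.bex _ (.inf (.ball _ (.sup (.mem _ _) (.equal _ _)))
      (.inf (.ball _ (.mem _ _)) (.mem _ _)))))

theorem realize_inductiveF {α : Type} {n : ℕ} (y : α ⊕ Fin n) (v : α → N) (xs : Fin n → N) :
    (inductiveF y).Realize v xs ↔ IsInductive (Sum.elim v xs y) := by
  simp only [inductiveF, FirstOrder.Language.BoundedFormula.realize_inf, realize_bexF,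
    realize_ballF, FirstOrder.Language.BoundedFormula.realize_sup, realize_memV, elim_up, elim_top,
    FirstOrder.Language.BoundedFormula.realize_bdEqual, FirstOrder.Language.Term.realize_var,
    FirstOrder.Language.BoundedFormula.realize_bot, IsInductive]
  refine and_congr Iff.rfl (forall_congr' fun a => imp_congr Iff.rfl (exists_congr fun s =>
    and_congr Iff.rfl ⟨fun h z => ⟨h.1 z, ?_⟩, fun h => ⟨fun z => (h z).1, fun z hz =>
      (h z).2 (Or.inl hz), (h a).2 (Or.inr rfl)⟩⟩))
  rintro (hz | rfl)
  exacts [h.2.1 z hz, h.2.2]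

/-- The formula saying that `&0` is the least inductive set. -/
def omegaF : setLang.BoundedFormula Empty 1 :=
  inductiveF top ⊓ ∀' (inductiveF top ⟹ ∀' (memV top (up (up top)) ⟹ memV top (up top)))

theorem realize_omegaF (v : Empty → N) (xs : Fin 1 → N) :
    omegaF.Realize v xs ↔ IsOmega (xs 0) := by
  have e : Sum.elim v xs top = xs 0 := rfl
  simp only [omegaF, FirstOrder.Language.BoundedFormula.realize_inf,
    FirstOrder.Language.BoundedFormula.realize_all, FirstOrder.Language.BoundedFormula.realize_imp,
    realize_inductiveF, realize_memV, elim_up, elim_top, e, IsOmega]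

theorem exists_inter (h : N ⊨ Mac) (a b : N) : ∃ c : N, ∀ x, Mem x c ↔ Mem x a ∧ Mem x b := by
  obtain ⟨c, hc⟩ := exists_separation h (n := 1)
    (φ := memV (Sum.inl (Sum.inr ())) (Sum.inl (Sum.inl 0))) (.mem _ _) (fun _ => b) a
  refine ⟨c, fun x => (hc x).trans (and_congr Iff.rfl ?_)⟩
  exact realize_memV _ _ _ _

theorem isInductive_of_inter (h : N ⊨ Mac) {a b c : N} (ha : IsInductive a) (hb : IsInductive b)
    (hc : ∀ x, Mem x c ↔ Mem x a ∧ Mem x b) : IsInductive c := by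
  obtain ⟨⟨e, he, hee⟩, hs⟩ := ha
  obtain ⟨⟨e', he', hee'⟩, hs'⟩ := hb
  obtain rfl : e = e' := ext_of_models h _ _ fun z => iff_of_false (hee z) (hee' z)
  refine ⟨⟨e, (hc e).2 ⟨he, he'⟩, hee⟩, fun y hy => ?_⟩
  obtain ⟨s, h1, h2⟩ := hs y ((hc y).1 hy).1
  obtain ⟨s', h1', h2'⟩ := hs' y ((hc y).1 hy).2
  obtain rfl : s = s' := ext_of_models h _ _ fun z => (h2 z).trans (h2' z).symm
  exact ⟨s, (hc s).2 ⟨h1, h1'⟩, h2⟩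

/-- Quantifying over all inductive sets is not bounded. Quantifying over inductive elements of the
power set of one inductive `I` is, and suffices because `I ∩ v` is inductive whenever `v` is. -/
theorem exists_isOmega (h : N ⊨ Mac) : ∃ w : N, IsOmega w := by
  obtain ⟨I, hI⟩ := exists_inductive h
  obtain ⟨p, hp⟩ := exists_powerset h I
  obtain ⟨w, hw⟩ := exists_separation h (n := 1)
    (φ := ballF (Sum.inl (Sum.inl 0)) (inductiveF top ⟹ memV (Sum.inl (Sum.inr ())) top))
    (.ball _ (.imp (isDelta0_inductiveF _) (.mem _ _))) (fun _ => p) I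
  have hw' : ∀ x, Mem x w ↔ Mem x I ∧ ∀ v, Mem v p → IsInductive v → Mem x v := by
    intro x
    refine (hw x).trans (and_congr Iff.rfl ?_)
    simp only [FirstOrder.Language.Formula.Realize, realize_ballF,
      FirstOrder.Language.BoundedFormula.realize_imp, realize_inductiveF, realize_memV, elim_top,
      Sum.elim_inl, Sum.elim_inr]
  have hall : ∀ x, Mem x w ↔ ∀ v, IsInductive v → Mem x v := by
    intro x
    refine (hw' x).trans ⟨fun hx v hv => ?_, fun hx => ⟨hx I hI, fun v _ hv => hx v hv⟩⟩
    obtain ⟨c, hc⟩ := exists_inter h I v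
    exact ((hc x).1 (hx.2 c ((hp c).2 fun z hz => ((hc z).1 hz).1)
      (isInductive_of_inter h hI hv hc))).2
  refine ⟨w, ⟨?_, ?_⟩, fun v hv n hn => (hall n).1 hn v hv⟩
  · obtain ⟨e, he, hee⟩ := hI.1
    refine ⟨e, (hall e).2 fun v hv => ?_, hee⟩
    obtain ⟨e', he', hee'⟩ := hv.1
    rwa [ext_of_models h e e' fun z => iff_of_false (hee z) (hee' z)]
  · intro y hy
    obtain ⟨s, _, hs⟩ := hI.2 y ((hall y).1 hy I hI)
    refine ⟨s, (hall s).2 fun v hv => ?_, hs⟩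
    obtain ⟨s', h1', hs'⟩ := hv.2 y ((hall y).1 hy v hv)
    rwa [ext_of_models h s s' fun z => (hs z).trans (hs' z).symm]

theorem exists_increasing {w : N} (hw : IsInductive w) :
    ∃ e : ℕ → N, (∀ n, Mem (e n) w) ∧ ∀ m n, m < n → Mem (e m) (e n) := by
  obtain ⟨⟨z, hz, _⟩, hs⟩ := hw
  choose S hS hS' using hs
  let e : ℕ → {y // Mem y w} := fun n => Nat.rec ⟨z, hz⟩ (fun _ y => ⟨S y.1 y.2, hS y.1 y.2⟩) n
  refine ⟨fun n => (e n).1, fun n => (e n).2, fun m n hmn => ?_⟩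
  induction n, hmn using Nat.le_induction with
  | base => exact (hS' _ (e m).2 _).2 (Or.inr rfl)
  | succ n _ ih => exact (hS' _ (e n).2 _).2 (Or.inl ih)

theorem isOrd_of_mem (hwf : WellFounded (Mem : N → N → Prop)) {α x : N} (hα : IsOrd α)
    (hx : Mem x α) : IsOrd x := by
  refine ⟨fun y z hy hz => ?_, fun y z hy hz => hα.2 y z (hα.1 x y hx hy) (hα.1 x z hx hz)⟩
  have hyα := hα.1 x y hx hy
  have hzα := hα.1 y z hyα hz
  rcases hα.2 z x hzα hx with h | rfl | h
  · exact h
  · exact absurd hy (hwf.asymmetric _ _ hz)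
  · have h3 : ¬ Relation.TransGen Mem x x := fun h' =>
      (WellFounded.transGen hwf).irrefl.irrefl x h'
    exact absurd (((Relation.TransGen.single h).tail hz).tail hy) h3

/-- Double induction on external well-foundedness: an incomparable pair whose elements are
comparable with the other side has the same elements. -/
theorem isOrd_trichotomy (h : N ⊨ Mac) (hwf : WellFounded (Mem : N → N → Prop)) :
    ∀ α β : N, IsOrd α → IsOrd β → Mem α β ∨ α = β ∨ Mem β α := by
  intro α
  induction α using hwf.induction with
  | _ α ihα =>
  intro β
  induction β using hwf.induction with
  | _ β ihβ =>
  intro hα hβ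
  by_contra! hne
  refine hne.2.1 (ext_of_models h _ _ fun z => ⟨fun hz => ?_, fun hz => ?_⟩)
  · rcases ihα z hz β (isOrd_of_mem hwf hα hz) hβ with h1 | rfl | h1
    · exact h1
    · exact absurd hz hne.2.2
    · exact absurd (hα.1 _ _ hz h1) hne.2.2
  · rcases ihβ z hz hα (isOrd_of_mem hwf hβ hz) with h1 | rfl | h1
    · exact absurd (hβ.1 _ _ hz h1) hne.1
    · exact absurd hz hne.1
    · exact h1

/-- The formula saying that `&0` is an ordinal. -/
def ordF : setLang.BoundedFormula Empty 1 :=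
  (∀' ∀' (memV (up top) (up (up top)) ⟹ (memV top (up top) ⟹ memV top (up (up top))))) ⊓
    ∀' ∀' (memV (up top) (up (up top)) ⟹ (memV top (up (up top)) ⟹
      (memV (up top) top ⊔ (FirstOrder.Language.Term.bdEqual (.var (up top)) (.var top) ⊔
        memV top (up top)))))

theorem realize_ordF (v : Empty → N) (xs : Fin 1 → N) :
    ordF.Realize v xs ↔ IsOrd (xs 0) := by
  have e : Sum.elim v xs top = xs 0 := rfl
  simp only [ordF, FirstOrder.Language.BoundedFormula.realize_inf,
    FirstOrder.Language.BoundedFormula.realize_all, FirstOrder.Language.BoundedFormula.realize_imp,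
    FirstOrder.Language.BoundedFormula.realize_sup,
    FirstOrder.Language.BoundedFormula.realize_bdEqual, FirstOrder.Language.Term.realize_var,
    realize_memV, elim_up, elim_top, e, IsOrd]

end Type0
-- The ultrapower iterated along `ℤ`, and its translation.
section IteratedUltrapower

variable (A : Type)

/-- The functions on sequences that depend on finitely many coordinates. -/
def FinDep : Type := {f : (ℤ → ℕ) → A // ∃ r : ℕ, DepOn (-r) r f}

/-- Equality at a generic sequence. -/
instance finDepSetoid : Setoid (FinDep A) where
  r f g := ∀ᶠ v in (generic : Filter (ℤ → ℕ)), f.1 v = g.1 v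
  iseqv :=
    { refl := fun _ => .of_forall fun _ => rfl
      symm := fun h => h.mono fun _ h => h.symm
      trans := fun h h' => by filter_upwards [h, h'] with v h1 h2 using h1.trans h2 }

/-- The ultrapower of `A` iterated along `ℤ`. -/
def IterPower : Type := Quotient (finDepSetoid A)

variable {A}

/-- The element of the iterated ultrapower that is represented by `f`. -/
def IterPower.mk (f : FinDep A) : IterPower A := Quotient.mk _ f

theorem IterPower.mk_eq_mk {f g : FinDep A} :
    IterPower.mk f = IterPower.mk g ↔ ∀ᶠ v in (generic : Filter (ℤ → ℕ)), f.1 v = g.1 v :=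
  Quotient.eq

theorem IterPower.mk_surjective : Function.Surjective (IterPower.mk (A := A)) :=
  Quotient.mk_surjective

/-- A finite tuple has a common window, so the witnesses in Łoś's theorem stay in `FinDep`. -/
theorem DepOn.comp_finDep {β : Type*} {n : ℕ} (xs : Fin n → FinDep A) (F : (Fin n → A) → β) :
    ∃ r : ℕ, DepOn (-r) r (fun v => F fun i => (xs i).1 v) := by
  choose r hr using fun i => (xs i).2
  refine ⟨Finset.univ.sup r, fun v w hvw => ?_⟩
  refine congrArg F (funext fun i => ?_)
  have : r i ≤ Finset.univ.sup r := Finset.le_sup (Finset.mem_univ i)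
  exact hr i v w fun k h1 h2 => hvw k (by omega) (by omega)

/-- The translate of a function. -/
def FinDep.shift (k : ℤ) (f : FinDep A) : FinDep A :=
  ⟨fun v => f.1 (MacLane.shift k v), by
    obtain ⟨r, hr⟩ := f.2
    exact ⟨r + k.natAbs, (hr.comp_shift k).mono (by omega) (by omega)⟩⟩

/-- A relation between two functions holds at a generic sequence iff it holds at its translate. -/
theorem FinDep.eventually_shift (R : A → A → Prop) (f g : FinDep A) :
    (∀ᶠ v in (generic : Filter (ℤ → ℕ)), R ((f.shift 1).1 v) ((g.shift 1).1 v)) ↔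
      ∀ᶠ v in (generic : Filter (ℤ → ℕ)), R (f.1 v) (g.1 v) := by
  obtain ⟨r, hr⟩ := DepOn.comp_finDep ![f, g] fun ys => R (ys 0) (ys 1)
  exact eventually_generic_shift hr

theorem FinDep.shift_shift (k l : ℤ) (f : FinDep A) : (f.shift k).shift l = f.shift (k + l) :=
  Subtype.ext (funext fun v => congrArg f.1 (MacLane.shift_shift k l v))

theorem FinDep.shift_zero (f : FinDep A) : f.shift 0 = f :=
  Subtype.ext (funext fun v => congrArg f.1 (MacLane.shift_zero v))

theorem IterPower.mk_shift_eq {f g : FinDep A} :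
    IterPower.mk (f.shift 1) = IterPower.mk (g.shift 1) ↔ IterPower.mk f = IterPower.mk g := by
  rw [IterPower.mk_eq_mk, IterPower.mk_eq_mk]
  exact FinDep.eventually_shift (· = ·) f g

/-- The translation, as a permutation of the iterated ultrapower. -/
noncomputable def IterPower.shiftPerm : IterPower A ≃ IterPower A :=
  Equiv.ofBijective
    (Quotient.map (FinDep.shift 1) fun f g h => Quotient.exact (IterPower.mk_shift_eq.2
      (Quotient.sound h)))
    ⟨fun x y => by
      obtain ⟨f, rfl⟩ := IterPower.mk_surjective x
      obtain ⟨g, rfl⟩ := IterPower.mk_surjective y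
      exact IterPower.mk_shift_eq.1,
    fun y => by
      obtain ⟨g, rfl⟩ := IterPower.mk_surjective y
      refine ⟨IterPower.mk (g.shift (-1)), congrArg IterPower.mk ?_⟩
      rw [FinDep.shift_shift, neg_add_cancel, FinDep.shift_zero]⟩

theorem IterPower.shiftPerm_mk (f : FinDep A) :
    IterPower.shiftPerm (IterPower.mk f) = IterPower.mk (f.shift 1) := rfl

variable [setLang.Structure A]

instance : setLang.Structure (IterPower A) where
  funMap := fun f => nomatch f
  RelMap | .mem => fun v =>
    ∀ᶠ z in (generic : Filter (ℤ → ℕ)), Mem ((v 0).out.1 z) ((v 1).out.1 z)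

theorem IterPower.mem_mk {f g : FinDep A} :
    Mem (IterPower.mk f) (IterPower.mk g) ↔
      ∀ᶠ v in (generic : Filter (ℤ → ℕ)), Mem (f.1 v) (g.1 v) := by
  have hf : ∀ᶠ v in (generic : Filter (ℤ → ℕ)), (IterPower.mk f).out.1 v = f.1 v :=
    IterPower.mk_eq_mk.1 (Quotient.out_eq _)
  have hg : ∀ᶠ v in (generic : Filter (ℤ → ℕ)), (IterPower.mk g).out.1 v = g.1 v :=
    IterPower.mk_eq_mk.1 (Quotient.out_eq _)
  refine Filter.eventually_congr ?_
  filter_upwards [hf, hg] with v h1 h2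
  change Mem ((IterPower.mk f).out.1 v) ((IterPower.mk g).out.1 v) ↔ _
  rw [h1, h2]

theorem realize_rel_mem {B : Type} [setLang.Structure B] {n : ℕ}
    (ts : Fin 2 → setLang.Term (Empty ⊕ Fin n)) (v : Empty → B) (xs : Fin n → B) :
    (FirstOrder.Language.BoundedFormula.rel (L := setLang) SetRel.mem ts).Realize v xs ↔
      Mem ((ts 0).realize (Sum.elim v xs)) ((ts 1).realize (Sum.elim v xs)) := by
  refine iff_of_eq (congrArg (FirstOrder.Language.Structure.RelMap (L := setLang) SetRel.mem)
    (funext fun i => ?_))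
  fin_cases i <;> rfl

theorem exists_term_var {n : ℕ} (t : setLang.Term (Empty ⊕ Fin n)) :
    ∃ i, t = FirstOrder.Language.Term.var (Sum.inr i) := by
  cases t with
  | var a =>
    rcases a with a | i
    exacts [a.elim, ⟨i, rfl⟩]
  | func f _ => exact nomatch f

/-- Łoś's theorem for the iterated ultrapower. -/
theorem IterPower.realize_mk [Nonempty A] {n : ℕ} (φ : setLang.BoundedFormula Empty n)
    (xs : Fin n → FinDep A) :
    φ.Realize default (fun i => IterPower.mk (xs i)) ↔
      ∀ᶠ v in (generic : Filter (ℤ → ℕ)), φ.Realize default (fun i => (xs i).1 v) := by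
  induction φ with
  | falsum =>
    simp only [FirstOrder.Language.BoundedFormula.Realize, Filter.eventually_const]
  | equal t s =>
    obtain ⟨i, rfl⟩ := exists_term_var t
    obtain ⟨k, rfl⟩ := exists_term_var s
    exact IterPower.mk_eq_mk
  | rel R ts =>
    cases R
    obtain ⟨i, hi⟩ := exists_term_var (ts 0)
    obtain ⟨k, hk⟩ := exists_term_var (ts 1)
    simp only [realize_rel_mem, hi, hk]
    exact IterPower.mem_mk
  | imp φ ψ ihφ ihψ =>
    simp only [FirstOrder.Language.BoundedFormula.realize_imp, ihφ, ihψ,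
      Ultrafilter.eventually_imp]
  | @all n φ ih =>
    have key : ∀ c : FinDep A,
        φ.Realize default (Fin.snoc (fun i => IterPower.mk (xs i)) (IterPower.mk c) :
          Fin (n + 1) → IterPower A) ↔
        ∀ᶠ v in (generic : Filter (ℤ → ℕ)),
          φ.Realize default (Fin.snoc (fun i => (xs i).1 v) (c.1 v) : Fin (n + 1) → A) := by
      intro c
      have := ih (Fin.snoc (α := fun _ => FinDep A) xs c)
      have e1 : (fun i => IterPower.mk (Fin.snoc (α := fun _ => FinDep A) xs c i)) =
          (Fin.snoc (fun i => IterPower.mk (xs i)) (IterPower.mk c) :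
            Fin (n + 1) → IterPower A) := Fin.comp_snoc IterPower.mk xs c
      have e2 : ∀ v, (fun i => (Fin.snoc (α := fun _ => FinDep A) xs c i).1 v) =
          (Fin.snoc (fun i => (xs i).1 v) (c.1 v) : Fin (n + 1) → A) := fun v =>
        Fin.comp_snoc (fun f : FinDep A => f.1 v) xs c
      rw [e1] at this
      simpa only [e2] using this
    simp only [FirstOrder.Language.BoundedFormula.realize_all]
    constructor
    · intro h
      -- `F` picks a counterexample if there is one, so truth at `F` implies truth everywhere.
      have hF : ∀ ys : Fin n → A, ∃ a, φ.Realize default (Fin.snoc ys a : Fin (n + 1) → A) →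
          ∀ b, φ.Realize default (Fin.snoc ys b : Fin (n + 1) → A) := by
        intro ys
        by_cases hy : ∀ b, φ.Realize default (Fin.snoc ys b : Fin (n + 1) → A)
        · exact ⟨Classical.arbitrary A, fun _ => hy⟩
        · obtain ⟨b, hb⟩ := not_forall.1 hy
          exact ⟨b, fun h => absurd h hb⟩
      choose F hF using hF
      refine ((key ⟨_, DepOn.comp_finDep xs F⟩).1 (h _)).mono fun v hv => hF _ hv
    · intro h x
      obtain ⟨c, rfl⟩ := IterPower.mk_surjective x
      exact (key c).2 (h.mono fun v hv => hv _)

theorem IterPower.elementarilyEquivalent [Nonempty A] : IterPower A ≅[setLang] A := by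
  refine FirstOrder.Language.elementarilyEquivalent_iff.2 fun φ => ?_
  have h := IterPower.realize_mk (A := A) φ default
  have e : ∀ (B : Type) (f : Fin 0 → B), f = default := fun _ _ => Subsingleton.elim _ _
  rw [e _ (fun i => IterPower.mk _)] at h
  simp only [e A (fun i => _), Filter.eventually_const] at h
  exact h

/-- The translation, as an automorphism of the iterated ultrapower. -/
noncomputable def IterPower.shiftEquiv : IterPower A ≃[setLang] IterPower A where
  toEquiv := IterPower.shiftPerm
  map_fun' := fun f => nomatch f
  map_rel' := by
    intro n R x
    cases R
    have e : ∀ y : Fin 2 → IterPower A, y = ![y 0, y 1] := fun y => by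
      funext i; fin_cases i <;> rfl
    rw [e x, e (_ ∘ _)]
    obtain ⟨f, hf⟩ := IterPower.mk_surjective (x 0)
    obtain ⟨g, hg⟩ := IterPower.mk_surjective (x 1)
    change Mem (IterPower.shiftPerm (x 0)) (IterPower.shiftPerm (x 1)) ↔ Mem (x 0) (x 1)
    rw [← hf, ← hg, IterPower.shiftPerm_mk, IterPower.shiftPerm_mk, IterPower.mem_mk,
      IterPower.mem_mk]
    exact FinDep.eventually_shift Mem f g

theorem IterPower.shiftEquiv_mk (f : FinDep A) :
    IterPower.shiftEquiv (IterPower.mk f) = IterPower.mk (f.shift 1) := rfl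

/-- The element represented by a constant function. -/
def FinDep.const (a : A) : FinDep A := ⟨fun _ => a, 0, fun _ _ _ => rfl⟩

theorem exists_automorphism (h : A ⊨ Mac) (hwf : WellFounded (Mem : A → A → Prop)) :
    ∃ (N : Type) (_ : setLang.Structure N),
      (N ≅[setLang] A) ∧
      ∃ j : N ≃[setLang] N,
        (∀ α : N, IsOrd α → Mem α (j α) ∨ j α = α) ∧
        (∃ w : N, IsOmega w ∧ ∃ n : N, Mem n w ∧ Mem n (j n)) := by
  obtain ⟨w, hw⟩ := exists_isOmega h
  obtain ⟨e, hew, helt⟩ := exists_increasing hw.1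
  have : Nonempty A := ⟨w⟩
  refine ⟨IterPower A, inferInstance, IterPower.elementarilyEquivalent, IterPower.shiftEquiv,
    fun α hα => ?_, IterPower.mk (FinDep.const w), ?_,
    IterPower.mk ⟨fun v => e (v 0), 1, fun v w hvw => ?_⟩, ?_, ?_⟩
  · obtain ⟨f, rfl⟩ := IterPower.mk_surjective α
    rw [IterPower.shiftEquiv_mk, IterPower.mem_mk, IterPower.mk_eq_mk, ← Ultrafilter.eventually_or]
    have hord : ∀ᶠ v in (generic : Filter (ℤ → ℕ)), IsOrd (f.1 v) := by
      have := (IterPower.realize_mk ordF fun _ => f).1 ((realize_ordF _ _).2 hα)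
      simpa only [realize_ordF] using this
    have hord' := (FinDep.eventually_shift (fun x _ => IsOrd x) f f).2 hord
    -- By the ultrafilter property, descent that is not generic generically fails; trichotomy in `A`
    -- then leaves only the desired cases.
    have hdesc : ∀ᶠ v in (generic : Filter (ℤ → ℕ)), ¬ Mem ((f.shift 1).1 v) (f.1 v) := by
      obtain ⟨r, hr⟩ := f.2
      exact Ultrafilter.eventually_not.2 (not_eventually_generic_descending hwf hr)
    filter_upwards [hord, hord', hdesc] with v h1 h2 h3
    rcases isOrd_trichotomy h hwf _ _ h1 h2 with h4 | h4 | h4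
    exacts [Or.inl h4, Or.inr h4.symm, absurd h4 h3]
  · refine (realize_omegaF default fun _ => _).1 ((IterPower.realize_mk omegaF _).2 ?_)
    exact .of_forall fun v => (realize_omegaF _ _).2 hw
  · exact congrArg e (hvw 0 (by norm_num) (by norm_num))
  · exact IterPower.mem_mk.2 (.of_forall fun v => hew _)
  · refine IterPower.mem_mk.2 (eventually_generic_lt.mono fun v hv => ?_)
    exact helt _ _ hv

end IteratedUltrapower
end MacLane

theorem mainTheorem7 (M : ZFSet) (hM : M.IsTransitive) (hMac : M ⊨ MacLane.Mac) :
    ∃ (N : Type) (_ : MacLane.setLang.Structure N),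
      (N ≅[MacLane.setLang] M) ∧
      ∃ j : N ≃[MacLane.setLang] N,
        (∀ α : N, MacLane.IsOrd α → MacLane.Mem α (j α) ∨ j α = α) ∧
        (∃ w : N, MacLane.IsOmega w ∧ ∃ n : N, MacLane.Mem n w ∧ MacLane.Mem n (j n)) := by
  -- Löwenheim–Skolem brings the model down to `Type`; its membership is still that of `ZFSet`,
  -- hence well-founded.
  obtain ⟨S, hS⟩ := FirstOrder.Language.exists_small_elementarySubstructure MacLane.setLang M
  let e : S ≃ Shrink.{0} S := equivShrink S
  let _ : MacLane.setLang.Structure (Shrink.{0} S) := e.inducedStructure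
  have hA : Shrink.{0} S ≅[MacLane.setLang] M :=
    e.inducedStructureEquiv.symm.toElementaryEmbedding.elementarilyEquivalent.trans
      S.elementarilyEquivalent
  have hMac' : Shrink.{0} S ⊨ MacLane.Mac := (hA.theory_model_iff (T := MacLane.Mac)).2 hMac
  have hwf : WellFounded (MacLane.Mem : Shrink.{0} S → Shrink.{0} S → Prop) :=
    Subrelation.wf (r := InvImage (· ∈ ·) fun x => ((e.symm x : M) : ZFSet))
      (fun {_ _} h => h) (InvImage.wf _ ZFSet.mem_wf)
  obtain ⟨N, i, hN, hj⟩ := MacLane.exists_automorphism hMac' hwf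
  exact ⟨N, i, hN.trans hA, hj⟩
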